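/- **Setting.** Let $M\ge 1$, $d_1,\dots,d_M\ge 2$, let $\psi^{(i)}\in\mathbb C^{d_i}_{A_i}\otimes\mathbb C^{d_i}_{B_i}$ ($1\le i\le M$) be arbitrary unit vectors with projectors $P_{\psi^{(i)}}$, and let $0\le p\le 1$. On $A:B$, with $A=A_1\cdots A_M$ and $B=B_1\cdots B_M$, consider the state $$\rho_p=\rho_p(\{\psi^{(i)}\})=(1-p)\bigotimes_{i=1}^M\frac{\mathbb 1-P_{\psi^{(i)}}}{d_i^2-1}+p\bigotimes_{i=1}^M P_{\psi^{(i)}} ,\qquad \mathcal N:=\prod_{i=1}^M\frac1{d_i^2-1}.$$ Let $\Gamma$ denote partial transposition on $A$ in the standard basis. A state $\rho$ is PPT if $\rho^\Gamma\ge0$ and NPT otherwise. It is *$n$-copy distillable* if there is a unit vector $\phi$ of Schmidt rank $2$ with respect to $A^{n}:B^{n}$ with $\langle\phi|(\rho^\Gamma)^{\otimes n}|\phi\rangle<0$, *distillable* if it is $n$-copy distillable for some $n\ge1$, and *NPT bound entangled* if it is NPT but not distillable. Let $\psi^{(i)}=\sum_{j=1}^{d_i}\mu^{(i)}_j\,|e^{(i)}_j\rangle\otimes|f^{(i)}_j\rangle$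 be any Schmidt decomposition, with orthonormal bases $e^{(i)},f^{(i)}$ and coefficients $\mu^{(i)}_1\ge\mu^{(i)}_2\ge\dots\ge\mu^{(i)}_{d_i}\ge0$ (padded by zeros). Write $|mn\rangle_i=|\overline{e^{(i)}_m}\rangle\otimes|f^{(i)}_n\rangle$, where the bar is entrywise complex conjugation (no conjugation appears if the Schmidt basis is the standard basis), and $|\psi^-_{mn}\rangle_i=(|mn\rangle_i-|nm\rangle_i)/\sqrt2$. For $1\le j\le M$, indices $k=(k_i)_{i}$ and $m\ne n$ put $$\Lambda_j(k;m,n)=(1-p)\,\mathcal N\prod_{i\ne j}\bigl(1-(\mu^{(i)}_{k_i})^2\bigr)\,\bigl(1+\mu^{(j)}_m\mu^{(j)}_n\bigr)-p\prod_{i\ne j}(\mu^{(i)}_{k_i})^2\;\mu^{(j)}_m\mu^{(j)}_n ,$$ and $\Lambda_j:=\Lambda_j((1,\dots,1);1,2)$. **Statement.** 1. If $\rho_p$ is NPT, then it is $1$-copy distillable, hence distillable. So no $\rho_p$ is NPT bound entangled. 2. For all $j$, $k$ and $m\neq n$, the vector $\bigotimes_{i\neq j}|k_ik_i\rangle_i\otimes|\psi^-_{mn}\rangle_j$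 is a unit vector of Schmidt rank $2$ with respect to $A:B$ and an eigenvector of $\rho_p^\Gamma$ with eigenvalue $\Lambda_j(k;m,n)$. 3. If $\rho_p$ is NPT, then the smallest eigenvalue of $\rho_p^\Gamma$ is $\Lambda_j$ for some $j$. For every $p\in[0,1]$ the smallest eigenvalue of $\rho_p^\Gamma$ is $$\min\Bigl\{(1-p)\,\mathcal N\prod_{i}\bigl(1-(\mu^{(i)}_1)^2\bigr)+p\prod_i(\mu^{(i)}_1)^2,\ \min_{j}\Lambda_j\Bigr\}.$$ 4. $\rho_p$ is PPT if and only if, for every $j$, $$p\,\prod_{i\ne j}(\mu_1^{(i)})^2\;\mu_1^{(j)}\mu_2^{(j)}\ \le\ (1-p)\,\mathcal N\prod_{i\ne j}\bigl(1-(\mu_1^{(i)})^2\bigr)\bigl(1+\mu_1^{(j)}\mu_2^{(j)}\bigr).$$ If moreover $p<1$ and every $\psi^{(i)}$ is entangled (i.e. $\mu^{(i)}_2>0$ for all $i$), this is equivalent to $$\frac{p}{(1-p)\mathcal N}\ \le\ \min_{1\le j\le M}\ \frac{\prod_{i\ne j}\bigl(1-(\mu_1^{(i)})^2\bigr)\bigl(1+\mu_1^{(j)}\mu_2^{(j)}\bigr)}{\prod_{i\ne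 j}(\mu_1^{(i)})^2\;\mu_1^{(j)}\mu_2^{(j)}} .$$ -/

import Mathlib

open scoped BigOperators Matrix ComplexOrder

noncomputable section

/-- The tensor product of operators `X i` on bipartite systems `A i : B i`, regarded as an operator
on the bipartite system `A : B` with `A` the product of all the `A i` and `B` of all the `B i`. -/
def localTensor {ι : Type*} [Fintype ι] {α β : ι → Type*}
    (X : ∀ i, Matrix (α i × β i) (α i × β i) ℂ) :
    Matrix ((∀ i, α i) × (∀ i, β i)) ((∀ i, α i) × (∀ i, β i)) ℂ :=
  Matrix.of fun x y => ∏ i, X i (x.1 i, x.2 i) (y.1 i, y.2 i)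

/-- The tensor product of vectors `v i` of bipartite systems `A i : B i`, with all the `A i` and
all the `B i` grouped together. -/
def localTensorVec {ι : Type*} [Fintype ι] {α β : ι → Type*}
    (v : ∀ i, α i × β i → ℂ) : (∀ i, α i) × (∀ i, β i) → ℂ :=
  fun x => ∏ i, v i (x.1 i, x.2 i)

/-- Partial transposition with respect to the first system, in the standard basis. -/
def partialTranspose {α β : Type*} (ρ : Matrix (α × β) (α × β) ℂ) : Matrix (α × β) (α × β) ℂ :=
  Matrix.of fun x y => ρ (y.1, x.2) (x.1, y.2)

/-- Positive partial transpose. -/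
def IsPPT {α β : Type*} (ρ : Matrix (α × β) (α × β) ℂ) : Prop :=
  (partialTranspose ρ).PosSemidef

/-- Nonpositive partial transpose. -/
def IsNPT {α β : Type*} (ρ : Matrix (α × β) (α × β) ℂ) : Prop :=
  ¬ IsPPT ρ

/-- The Schmidt rank of a vector of a bipartite system: the rank of its coefficient matrix. -/
def schmidtRank {α β : Type*} [Fintype β] (φ : α × β → ℂ) : ℕ :=
  (Matrix.of fun a b => φ (a, b)).rank

/-- `ρ` is `n`-copy distillable: a unit vector of Schmidt rank 2 (with respect to the cut of
all the first systems against all the second systems) has negative expectation value in the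
`n`-th tensor power of the partial transpose. -/
def IsCopyDistillable {α β : Type*} [Fintype α] [Fintype β] (n : ℕ)
    (ρ : Matrix (α × β) (α × β) ℂ) : Prop :=
  ∃ φ : (Fin n → α) × (Fin n → β) → ℂ,
    star φ ⬝ᵥ φ = 1 ∧ schmidtRank φ = 2 ∧
      (star φ ⬝ᵥ (localTensor (fun _ : Fin n => partialTranspose ρ) *ᵥ φ)).re < 0

/-- `ρ` is distillable: it is `n`-copy distillable for some number of copies `n ≥ 1`. -/
def IsDistillable {α β : Type*} [Fintype α] [Fintype β] (ρ : Matrix (α × β) (α × β) ℂ) : Prop :=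
  ∃ n : ℕ, 1 ≤ n ∧ IsCopyDistillable n ρ

/-- NPT bound entangled: NPT (hence entangled) and not distillable. -/
def IsNPTBoundEntangled {α β : Type*} [Fintype α] [Fintype β]
    (ρ : Matrix (α × β) (α × β) ℂ) : Prop :=
  IsNPT ρ ∧ ¬ IsDistillable ρ

/-- The projector onto the pure state `ψ`. -/
def pureProj {α : Type*} (ψ : α → ℂ) : Matrix α α ℂ :=
  Matrix.vecMulVec ψ (star ψ)

/-- The state `(1 - p) ⨂ᵢ (1 - P_{ψᵢ}) / (dᵢ² - 1) + p ⨂ᵢ P_{ψᵢ}`. -/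
def rhoP {M : ℕ} {d : Fin M → ℕ} (ψ : ∀ i, Fin (d i) × Fin (d i) → ℂ) (p : ℝ) :
    Matrix ((∀ i, Fin (d i)) × (∀ i, Fin (d i))) ((∀ i, Fin (d i)) × (∀ i, Fin (d i))) ℂ :=
  ((1 - p : ℝ) : ℂ) •
      localTensor (fun i => ((1 / ((d i : ℝ) ^ 2 - 1) : ℝ) : ℂ) • (1 - pureProj (ψ i)))
    + (p : ℂ) • localTensor (fun i => pureProj (ψ i))

/-- A Schmidt decomposition of `ψ`, with the coefficients in nonincreasing order and padded by
zeros beyond the Schmidt rank, and the Schmidt vectors completed to orthonormal bases. -/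
structure SchmidtDecomposition {d : ℕ} (ψ : Fin d × Fin d → ℂ) where
  /-- the Schmidt coefficients -/
  coeff : Fin d → ℝ
  /-- the Schmidt basis of the first system -/
  basisA : OrthonormalBasis (Fin d) ℂ (EuclideanSpace ℂ (Fin d))
  /-- the Schmidt basis of the second system -/
  basisB : OrthonormalBasis (Fin d) ℂ (EuclideanSpace ℂ (Fin d))
  coeff_nonneg : ∀ j, 0 ≤ coeff j
  coeff_antitone : Antitone coeff
  eq_sum : ∀ a b, ψ (a, b) = ∑ j, (coeff j : ℂ) * (basisA j a * basisB j b)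

/-- The vector `|mn⟩`. Partial transposition is taken in the standard basis, so the first factor is
the entrywise conjugate of the Schmidt vector; this is the Schmidt vector itself when the
Schmidt basis is the standard one. -/
def SchmidtDecomposition.ket {d : ℕ} {ψ : Fin d × Fin d → ℂ} (S : SchmidtDecomposition ψ)
    (m n : Fin d) : Fin d × Fin d → ℂ :=
  fun x => star (S.basisA m x.1) * S.basisB n x.2

/-- The vector `|ψ⁻_{mn}⟩ = (|mn⟩ - |nm⟩) / √2`. -/
def SchmidtDecomposition.psiMinus {d : ℕ} {ψ : Fin d × Fin d → ℂ} (S : SchmidtDecomposition ψ)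
    (m n : Fin d) : Fin d × Fin d → ℂ :=
  fun x => (S.ket m n x - S.ket n m x) / ((Real.sqrt 2 : ℝ) : ℂ)

/-- The vector `|ψ⁻_{mn}⟩` on the pair `j`, tensored with `|kᵢ kᵢ⟩` on every other pair `i`. -/
def pairVector {M : ℕ} {d : Fin M → ℕ} {ψ : ∀ i, Fin (d i) × Fin (d i) → ℂ}
    (S : ∀ i, SchmidtDecomposition (ψ i)) (j : Fin M) (k : ∀ i, Fin (d i)) (m n : Fin (d j)) :
    (∀ i, Fin (d i)) × (∀ i, Fin (d i)) → ℂ :=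
  localTensorVec (Function.update (fun i => (S i).ket (k i) (k i)) j ((S j).psiMinus m n))

/-- The product of the normalization factors `1 / (dᵢ² - 1)`. -/
def normFactor {M : ℕ} (d : Fin M → ℕ) : ℝ :=
  ∏ i, 1 / ((d i : ℝ) ^ 2 - 1)

/-- The number `(1 - p) 𝒩 ∏_{i ≠ j} (1 - (μⁱ_{kᵢ})²) (1 + μʲ_m μʲ_n)
  - p ∏_{i ≠ j} (μⁱ_{kᵢ})² μʲ_m μʲ_n`. -/
def pairEigenvalue {M : ℕ} {d : Fin M → ℕ} (μ : ∀ i, Fin (d i) → ℝ) (p : ℝ)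
    (j : Fin M) (k : ∀ i, Fin (d i)) (m n : Fin (d j)) : ℝ :=
  (1 - p) * normFactor d * (∏ i ∈ Finset.univ.erase j, (1 - μ i (k i) ^ 2)) * (1 + μ j m * μ j n)
    - p * (∏ i ∈ Finset.univ.erase j, μ i (k i) ^ 2) * (μ j m * μ j n)

end

/-! With `c = (1 - p) 𝒩`, the operator `ρ_p^Γ` is `c ⨂ (1 - Pᵢ^Γ) + p ⨂ Pᵢ^Γ` up to the factor 𝒩
being spread over the sites, so products of local eigenvectors diagonalize it. Locally `P^Γ` sends
`|mn⟩` to `μ_m μ_n |nm⟩`: its eigenvectors are `|kk⟩` and `|ψ^±_{mn}⟩`, with eigenvalues `μ_k²` and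
`±μ_m μ_n`. Every eigenvalue of `ρ_p^Γ` is therefore `F(x) = c ∏ (1 - xᵢ) + p ∏ xᵢ` with `xᵢ ∈ [-bᵢ,
aᵢ]`, where `aᵢ = μ₁²` and `bᵢ = μ₁μ₂`.

`F` is affine in each coordinate, and once some `xⱼ = -bⱼ`, raising all other coordinates to `aᵢ`
only lowers `F`. So the minimum over the box is `F(a)` or some `Λ_j`, with exactly one coordinate
moved to `-bⱼ` (`le_mixedProd_of_mem_box`); all these values are eigenvalues. Since `F(a) ≥ 0`, NPT
forces some `Λ_j < 0`. Its eigenvector is antisymmetric on one pair and a product on the others,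
hence of Schmidt rank 2 (`schmidtRank_pairVector`): it witnesses 1-copy distillability. -/

/-! ### Tensor products across the bipartition -/

section Tensor

variable {ι : Type*} [Fintype ι] [DecidableEq ι] {α β : ι → Type*}

/-- Splitting a sum of products over a product of families into a product of sums. -/
theorem sum_prod_pi_prod [∀ i, Fintype (α i)] [∀ i, Fintype (β i)] (f : ∀ i, α i × β i → ℂ) :
    ∑ x : (∀ i, α i) × (∀ i, β i), ∏ i, f i (x.1 i, x.2 i) = ∏ i, ∑ y, f i y := by
  classical
  rw [Fintype.prod_sum]
  exact Fintype.sum_equiv (Equiv.arrowProdEquivProdArrow ι α β).symm _ _ fun x => rfl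

theorem star_localTensorVec_dotProduct [∀ i, Fintype (α i)] [∀ i, Fintype (β i)]
    (v w : ∀ i, α i × β i → ℂ) :
    star (localTensorVec v) ⬝ᵥ localTensorVec w = ∏ i, star (v i) ⬝ᵥ w i := by
  simp only [dotProduct, localTensorVec, Pi.star_apply, star_prod, ← Finset.prod_mul_distrib]
  exact sum_prod_pi_prod fun i y => star (v i y) * w i y

theorem localTensor_mulVec [∀ i, Fintype (α i)] [∀ i, Fintype (β i)]
    (X : ∀ i, Matrix (α i × β i) (α i × β i) ℂ) (v : ∀ i, α i × β i → ℂ) :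
    localTensor X *ᵥ localTensorVec v = localTensorVec fun i => X i *ᵥ v i := by
  ext x
  simp only [Matrix.mulVec, dotProduct, localTensorVec, localTensor, Matrix.of_apply,
    ← Finset.prod_mul_distrib]
  exact sum_prod_pi_prod fun i y => X i (x.1 i, x.2 i) y * v i y

omit [DecidableEq ι] in
theorem localTensorVec_smul (c : ι → ℂ) (v : ∀ i, α i × β i → ℂ) :
    localTensorVec (fun i => c i • v i) = (∏ i, c i) • localTensorVec v := by
  ext x
  simp [localTensorVec, Finset.prod_mul_distrib]

omit [DecidableEq ι] in
theorem partialTranspose_localTensor (X : ∀ i, Matrix (α i × β i) (α i × β i) ℂ) :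
    partialTranspose (localTensor X) = localTensor fun i => partialTranspose (X i) := rfl

end Tensor

section PartialTranspose

variable {α β : Type*}

theorem partialTranspose_add (X Y : Matrix (α × β) (α × β) ℂ) :
    partialTranspose (X + Y) = partialTranspose X + partialTranspose Y := rfl

theorem partialTranspose_sub (X Y : Matrix (α × β) (α × β) ℂ) :
    partialTranspose (X - Y) = partialTranspose X - partialTranspose Y := rfl

theorem partialTranspose_smul (c : ℂ) (X : Matrix (α × β) (α × β) ℂ) :
    partialTranspose (c • X) = c • partialTranspose X := rfl

theorem partialTranspose_one [DecidableEq α] [DecidableEq β] :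
    partialTranspose (1 : Matrix (α × β) (α × β) ℂ) = 1 := by
  ext ⟨a, b⟩ ⟨a', b'⟩
  simp only [partialTranspose, Matrix.of_apply, Matrix.one_apply, Prod.mk.injEq]
  exact if_congr (and_congr_left' eq_comm) rfl rfl

end PartialTranspose

/-! ### Spectrum and positivity from an orthonormal eigenbasis -/

section Eigenbasis

variable {n : Type*} [Fintype n] [DecidableEq n] {A : Matrix n n ℂ} {v : n → n → ℂ} {Λ : n → ℝ}

/-- A matrix with an orthonormal basis of eigenvectors is unitarily diagonalized by it. -/
theorem exists_unitary_diagonalization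
    (hv : ∀ i j, star (v i) ⬝ᵥ v j = if i = j then 1 else 0)
    (hA : ∀ i, A *ᵥ v i = (Λ i : ℂ) • v i) :
    ∃ U : unitary (Matrix n n ℂ),
      A = (U : Matrix n n ℂ) * Matrix.diagonal (fun i => (Λ i : ℂ)) * star (U : Matrix n n ℂ) := by
  set W : Matrix n n ℂ := Matrix.of fun x i => v i x
  have hW : star W * W = 1 := by
    ext i j
    rw [Matrix.one_apply, ← hv i j]
    rfl
  -- `W` is square because the family is indexed by `n` itself; orthonormality thus gives
  -- completeness.
  have hW' : W * star W = 1 := mul_eq_one_comm.mp hW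
  have hAW : A * W = W * Matrix.diagonal (fun i => (Λ i : ℂ)) := by
    ext x i
    have := congrFun (hA i) x
    rw [Matrix.mul_diagonal, mul_comm]
    exact this
  exact ⟨⟨W, hW, hW'⟩, by
    change A = W * _ * star W
    rw [← hAW, mul_assoc, hW', mul_one]⟩

theorem spectrum_eq_range_of_eigenbasis
    (hv : ∀ i j, star (v i) ⬝ᵥ v j = if i = j then 1 else 0)
    (hA : ∀ i, A *ᵥ v i = (Λ i : ℂ) • v i) : spectrum ℝ A = Set.range Λ := by
  obtain ⟨U, hU⟩ := exists_unitary_diagonalization hv hA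
  rw [hU, Unitary.spectrum_star_right_conjugate]
  ext r
  rw [spectrum.mem_iff]
  have : algebraMap ℝ (Matrix n n ℂ) r - Matrix.diagonal (fun i => (Λ i : ℂ))
      = Matrix.diagonal fun i => ((r - Λ i : ℝ) : ℂ) := by
    rw [Matrix.algebraMap_eq_diagonal, Matrix.diagonal_sub]
    congr 1
    ext i
    simp
  rw [this, Matrix.isUnit_diagonal, Pi.isUnit_iff]
  simp only [isUnit_iff_ne_zero, ne_eq, Complex.ofReal_eq_zero, sub_eq_zero, not_forall, not_not,
    Set.mem_range, eq_comm]

theorem posSemidef_iff_of_eigenbasis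
    (hv : ∀ i j, star (v i) ⬝ᵥ v j = if i = j then 1 else 0)
    (hA : ∀ i, A *ᵥ v i = (Λ i : ℂ) • v i) : A.PosSemidef ↔ ∀ i, 0 ≤ Λ i := by
  obtain ⟨U, hU⟩ := exists_unitary_diagonalization hv hA
  rw [hU, Matrix.IsUnit.posSemidef_star_right_conjugate_iff (Unitary.isUnit_coe (U := U)),
    Matrix.posSemidef_diagonal_iff]
  simp

end Eigenbasis

/-! ### Schmidt rank and one-copy witnesses -/

/-- A combination `∑ c s • u s ⊗ v s` of two terms, with `u`, `v` orthonormal pairs and nonzero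
coefficients, has Schmidt rank 2. -/
theorem schmidtRank_eq_two {α β : Type*} [Fintype α] [Fintype β] {φ : α × β → ℂ}
    {u : Fin 2 → α → ℂ} {v : Fin 2 → β → ℂ} {c : Fin 2 → ℂ} (hc : ∀ s, c s ≠ 0)
    (hu : ∀ s t, star (u s) ⬝ᵥ u t = if s = t then 1 else 0)
    (hv : ∀ s t, star (v s) ⬝ᵥ v t = if s = t then 1 else 0)
    (hφ : ∀ a b, φ (a, b) = ∑ s, c s * (u s a * v s b)) : schmidtRank φ = 2 := by
  set U : Matrix α (Fin 2) ℂ := Matrix.of fun a s => u s a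
  set V : Matrix β (Fin 2) ℂ := Matrix.of fun b s => v s b
  have hU : Uᴴ * U = 1 := by
    ext i j
    rw [Matrix.one_apply, ← hu i j]
    rfl
  have hV : Vᴴ * V = 1 := by
    ext i j
    rw [Matrix.one_apply, ← hv i j]
    rfl
  have hV' : Vᵀ * Vᴴᵀ = 1 := by rw [← Matrix.transpose_mul, hV, Matrix.transpose_one]
  have hC : (Matrix.of fun a b => φ (a, b)) = U * Matrix.diagonal c * Vᵀ := by
    ext a b
    rw [Matrix.of_apply, hφ, Matrix.mul_apply]
    refine Finset.sum_congr rfl fun s _ => ?_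
    rw [Matrix.mul_diagonal, Matrix.transpose_apply]
    simp only [U, V, Matrix.of_apply]
    ring
  unfold schmidtRank
  refine le_antisymm ?_ ?_
  · rw [hC]
    exact (Matrix.rank_mul_le_left _ _).trans
      ((Matrix.rank_le_card_width _).trans (by simp))
  -- Compressing by the two isometries recovers the invertible matrix `diagonal c`, and compression
  -- cannot raise the rank.
  · have h1 : Uᴴ * ((Matrix.of fun a b => φ (a, b)) * Vᴴᵀ) = Matrix.diagonal c := by
      rw [hC, Matrix.mul_assoc, hV', Matrix.mul_one, ← Matrix.mul_assoc, hU, Matrix.one_mul]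
    have h2 : (Matrix.diagonal c).rank = 2 := by
      have := Matrix.rank_of_isUnit (Matrix.diagonal c)
        (Matrix.isUnit_diagonal.mpr (Pi.isUnit_iff.mpr fun s => (hc s).isUnit))
      simpa using this
    calc 2 = (Uᴴ * ((Matrix.of fun a b => φ (a, b)) * Vᴴᵀ)).rank := by rw [h1, h2]
      _ ≤ _ := (Matrix.rank_mul_le_right _ _).trans (Matrix.rank_mul_le_left _ _)

/-- With a single copy, a vector of the system itself witnesses distillability. -/
theorem isCopyDistillable_one {α β : Type*} [Fintype α] [Fintype β] {ρ : Matrix (α × β) (α × β) ℂ}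
    {φ : α × β → ℂ} (h1 : star φ ⬝ᵥ φ = 1) (h2 : schmidtRank φ = 2)
    (h3 : (star φ ⬝ᵥ (partialTranspose ρ *ᵥ φ)).re < 0) : IsCopyDistillable 1 ρ := by
  have key (w : α × β → ℂ) :
      star (localTensorVec fun _ : Fin 1 => φ) ⬝ᵥ localTensorVec (fun _ : Fin 1 => w)
        = star φ ⬝ᵥ w := by
    rw [star_localTensorVec_dotProduct, Fin.prod_univ_one]
  refine ⟨localTensorVec fun _ : Fin 1 => φ, by rw [key, h1], ?_, ?_⟩
  · have := Matrix.rank_submatrix (Matrix.of fun a b => φ (a, b))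
      (Equiv.funUnique (Fin 1) α) (Equiv.funUnique (Fin 1) β)
    rw [← h2, schmidtRank, schmidtRank, ← this]
    congr 1
    ext a b
    simp [localTensorVec]
  · rw [localTensor_mulVec, key]
    exact h3

/-! ### Existence of Schmidt decompositions -/

theorem EuclideanSpace.inner_eq_sum_star_mul {n : Type*} [Fintype n] (x y : EuclideanSpace ℂ n) :
    inner ℂ x y = ∑ i, star (x i) * y i := by
  simp [PiLp.inner_apply, mul_comm]

theorem EuclideanSpace.inner_toLp_star {n : Type*} [Fintype n] (x y : n → ℂ) :
    inner ℂ (WithLp.toLp 2 (star x) : EuclideanSpace ℂ n) (WithLp.toLp 2 (star y))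
      = star y ⬝ᵥ x := by
  simp [EuclideanSpace.inner_eq_sum_star_mul, dotProduct, mul_comm]

/-- Completeness of an orthonormal basis, in coordinates. -/
theorem OrthonormalBasis.sum_mul_star {n m : Type*} [Fintype n] [DecidableEq n] [Fintype m]
    (f : OrthonormalBasis m ℂ (EuclideanSpace ℂ n)) (b c : n) :
    ∑ j, f j b * star (f j c) = if b = c then 1 else 0 := by
  have h := congrArg (fun v : EuclideanSpace ℂ n => v b)
    (f.sum_repr' (EuclideanSpace.single c (1 : ℂ)))
  simpa [PiLp.inner_apply, PiLp.single_apply, mul_comm] using h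

/-- Every vector of a bipartite system has a Schmidt decomposition. -/
theorem nonempty_schmidtDecomposition {d : ℕ} (ψ : Fin d × Fin d → ℂ) :
    Nonempty (SchmidtDecomposition ψ) := by
  -- The entries are conjugated so that the eigenvectors `f` of `Cᴴ * C` serve as right Schmidt
  -- vectors unchanged, with `star (C f_j) = μ_j e_j`.
  set C : Matrix (Fin d) (Fin d) ℂ := Matrix.of fun a b => star (ψ (a, b))
  have hG := Matrix.posSemidef_conjTranspose_mul_self C
  -- `Tuple.sort` sorts increasingly; the sign makes the eigenvalues decrease.
  set τ := Tuple.sort fun i => -hG.1.eigenvalues i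
  have hτ : Antitone fun i => hG.1.eigenvalues (τ i) := fun i j hij =>
    neg_le_neg_iff.mp (Tuple.monotone_sort (fun i => -hG.1.eigenvalues i) hij)
  set ν : Fin d → ℝ := fun i => hG.1.eigenvalues (τ i)
  have hν (i) : 0 ≤ ν i := hG.eigenvalues_nonneg _
  set f := hG.1.eigenvectorBasis.reindex τ.symm
  have hf (j) : (Cᴴ * C) *ᵥ (f j).ofLp = ((ν j : ℝ) : ℂ) • (f j).ofLp := by
    simpa [f] using hG.1.mulVec_eigenvectorBasis (τ j)
  -- the images of the right Schmidt vectors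
  set g : Fin d → EuclideanSpace ℂ (Fin d) := fun j => WithLp.toLp 2 (star (C *ᵥ (f j).ofLp))
  have hg (i j) : inner ℂ (g i) (g j) = if i = j then ((ν i : ℝ) : ℂ) else 0 := by
    have h1 : inner ℂ (g i) (g j) = star (f j).ofLp ⬝ᵥ ((Cᴴ * C) *ᵥ (f i).ofLp) := by
      rw [← Matrix.mulVec_mulVec, Matrix.dotProduct_mulVec, ← Matrix.star_mulVec]
      exact EuclideanSpace.inner_toLp_star _ _
    rw [h1, hf, dotProduct_smul]
    have h2 := orthonormal_iff_ite.mp f.orthonormal j i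
    rw [EuclideanSpace.inner_eq_sum_star_mul] at h2
    have h3 : star (f j).ofLp ⬝ᵥ (f i).ofLp = if j = i then 1 else 0 := h2
    rw [h3]
    by_cases hij : i = j
    · simp [hij]
    · simp [hij, Ne.symm hij]
  set μ : Fin d → ℝ := fun j => Real.sqrt (ν j)
  have hμ (j) : ((μ j : ℝ) : ℂ) * (μ j : ℂ) = (ν j : ℂ) := by
    rw [← Complex.ofReal_mul, Real.mul_self_sqrt (hν j)]
  -- Only the nonzero `g j` can be normalized; the remaining left Schmidt vectors come from an
  -- arbitrary completion, harmless because `g j = 0` when `μ j = 0`.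
  have horth : Orthonormal ℂ
      ({j | μ j ≠ 0}.domRestrict fun j => ((μ j : ℝ) : ℂ)⁻¹ • g j) := by
    rw [orthonormal_iff_ite]
    rintro ⟨i, hi⟩ ⟨j, hj⟩
    have hi' : ((μ i : ℝ) : ℂ) ≠ 0 := Complex.ofReal_ne_zero.mpr hi
    simp only [Set.domRestrict_apply, inner_smul_left, inner_smul_right, hg, Subtype.mk.injEq]
    by_cases hij : i = j
    · subst hij
      simp only [if_true, ← hμ, map_inv₀, Complex.conj_ofReal]
      field_simp
    · simp [hij]
  obtain ⟨e, he⟩ := horth.exists_orthonormalBasis_extension_of_card_eq (by simp)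
  have heg (j) : ((μ j : ℝ) : ℂ) • e j = g j := by
    by_cases hj : μ j = 0
    · have : inner ℂ (g j) (g j) = (0 : ℂ) := by rw [hg, if_pos rfl, ← hμ, hj]; simp
      rw [hj, inner_self_eq_zero.mp this]
      simp
    · rw [he j hj, smul_smul, mul_inv_cancel₀ (Complex.ofReal_ne_zero.mpr hj), one_smul]
  refine ⟨⟨μ, e, f, fun j => Real.sqrt_nonneg _, fun i j hij => Real.sqrt_le_sqrt (hτ hij), ?_⟩⟩
  intro a b
  have h1 (j) : ((μ j : ℝ) : ℂ) * (e j a * f j b) = ∑ c, ψ (a, c) * (f j b * star (f j c)) := by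
    have h2 : ((μ j : ℝ) : ℂ) * e j a = ∑ c, ψ (a, c) * star (f j c) := by
      have := congrArg (fun v : EuclideanSpace ℂ (Fin d) => v a) (heg j)
      simpa [g, C, Matrix.mulVec, dotProduct] using this
    rw [← mul_assoc, h2, Finset.sum_mul]
    exact Finset.sum_congr rfl fun c _ => by ring
  simp only [h1]
  rw [Finset.sum_comm]
  simp only [← Finset.mul_sum, OrthonormalBasis.sum_mul_star]
  simp

/-! ### Local spectral decomposition of the partially transposed projector -/

namespace SchmidtDecomposition

variable {d : ℕ} {ψ : Fin d × Fin d → ℂ} (S : SchmidtDecomposition ψ)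

theorem star_basisA_dotProduct (m n : Fin d) :
    ∑ a, star (S.basisA m a) * S.basisA n a = if m = n then 1 else 0 := by
  rw [← EuclideanSpace.inner_eq_sum_star_mul]
  exact orthonormal_iff_ite.mp S.basisA.orthonormal m n

theorem star_basisB_dotProduct (m n : Fin d) :
    ∑ b, star (S.basisB m b) * S.basisB n b = if m = n then 1 else 0 := by
  rw [← EuclideanSpace.inner_eq_sum_star_mul]
  exact orthonormal_iff_ite.mp S.basisB.orthonormal m n

theorem star_ket_dotProduct (m n m' n' : Fin d) :
    star (S.ket m n) ⬝ᵥ S.ket m' n' = (if m = m' then 1 else 0) * (if n = n' then 1 else 0) := by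
  -- The conjugate in `ket` reverses the inner product on the first system, so that delta is needed
  -- with its indices exchanged.
  have h : (if m = m' then (1 : ℂ) else 0) = if m' = m then 1 else 0 := by simp only [eq_comm]
  rw [h, ← S.star_basisA_dotProduct, ← S.star_basisB_dotProduct, Finset.sum_mul_sum,
    ← Finset.sum_product']
  refine Finset.sum_congr rfl fun x _ => ?_
  simp only [ket, Pi.star_apply, star_mul', star_star]
  ring

/-- Contracting the Schmidt sum with one basis vector leaves a single term. This serves both the
norm of `ψ` and the action of `P^Γ`. -/
theorem sum_star_mul_basisB (n a : Fin d) :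
    ∑ b', star (ψ (a, b')) * S.basisB n b' = S.coeff n * star (S.basisA n a) := by
  simp only [S.eq_sum, star_sum, star_mul', Finset.sum_mul, Complex.star_def, Complex.conj_ofReal]
  simp only [← Complex.star_def]
  rw [Finset.sum_comm, Finset.sum_eq_single n]
  -- The factor 1 is expanded as `⟨f_n|f_n⟩`, after which both sides are sums that agree termwise;
  -- the next case does the same with 0.
  · rw [← mul_one ((S.coeff n : ℂ) * _), ← if_pos (c := n = n) rfl (t := (1 : ℂ)) (e := 0),
      ← S.star_basisB_dotProduct, Finset.mul_sum]
    exact Finset.sum_congr rfl fun a _ => by ring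
  · intro j _ hj
    rw [← mul_zero ((S.coeff j : ℂ) * star (S.basisA j a)),
      ← if_neg (c := j = n) hj (t := (1 : ℂ)) (e := 0),
      ← S.star_basisB_dotProduct, Finset.mul_sum]
    exact Finset.sum_congr rfl fun a _ => by ring
  · simp
theorem sum_coeff_sq (hψ : star ψ ⬝ᵥ ψ = 1) : ∑ j, S.coeff j ^ 2 = 1 := by
  have h : star ψ ⬝ᵥ ψ = ∑ n, ((S.coeff n : ℝ) : ℂ) * ∑ a, S.basisA n a *
      ∑ b, star (ψ (a, b)) * S.basisB n b := by
    have h1 (x : Fin d × Fin d) : star (ψ x) * ψ x = ∑ n, ((S.coeff n : ℝ) : ℂ) *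
        (S.basisA n x.1 * (star (ψ x) * S.basisB n x.2)) := by
      have h2 : ψ x = _ := S.eq_sum x.1 x.2
      -- Only the unconjugated factor is to be expanded: `h2` rewrites both, and the reverse rewrite
      -- restores the conjugated one.
      conv_lhs => rw [mul_comm, h2, Finset.sum_mul, ← h2]
      exact Finset.sum_congr rfl fun n _ => by ring
    simp only [dotProduct, Pi.star_apply, h1]
    rw [Finset.sum_comm]
    simp only [Fintype.sum_prod_type, Finset.mul_sum]
  have h' : ((∑ j, S.coeff j ^ 2 : ℝ) : ℂ) = 1 := by
    rw [← hψ, h, Complex.ofReal_sum]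
    refine Finset.sum_congr rfl fun n _ => ?_
    have : ∑ a, S.basisA n a * ∑ b, star (ψ (a, b)) * S.basisB n b = S.coeff n := by
      have := S.star_basisA_dotProduct n n
      simp only [S.sum_star_mul_basisB]
      rw [if_pos rfl] at this
      conv_rhs => rw [← mul_one (S.coeff n : ℂ), ← this, Finset.mul_sum]
      exact Finset.sum_congr rfl fun a _ => by ring
    rw [this, Complex.ofReal_pow, sq]
  exact_mod_cast h'

/-- The entries of `P^Γ` are `ψ(a',b) * star ψ(a,b')`, so on a product vector the sum factors into
two contractions. Each returns the Schmidt vector of the opposite system, which exchanges the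
indices. -/
theorem partialTranspose_pureProj_mulVec_ket (m n : Fin d) :
    partialTranspose (pureProj ψ) *ᵥ S.ket m n
      = ((S.coeff m * S.coeff n : ℝ) : ℂ) • S.ket n m := by
  have hA (b : Fin d) : ∑ a', ψ (a', b) * star (S.basisA m a') = S.coeff m * S.basisB m b := by
    simp only [S.eq_sum, Finset.sum_mul]
    rw [Finset.sum_comm, Finset.sum_eq_single m]
    · rw [← mul_one ((S.coeff m : ℂ) * _), ← if_pos (c := m = m) rfl (t := (1 : ℂ)) (e := 0),
        ← S.star_basisA_dotProduct, Finset.mul_sum]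
      exact Finset.sum_congr rfl fun a _ => by ring
    · intro j _ hj
      rw [← mul_zero ((S.coeff j : ℂ) * S.basisB j b),
        ← if_neg (c := m = j) hj.symm (t := (1 : ℂ)) (e := 0),
        ← S.star_basisA_dotProduct, Finset.mul_sum]
      exact Finset.sum_congr rfl fun a _ => by ring
    · simp
  ext ⟨a, b⟩
  have : (partialTranspose (pureProj ψ) *ᵥ S.ket m n) (a, b)
      = (∑ a', ψ (a', b) * star (S.basisA m a')) * ∑ b', star (ψ (a, b')) * S.basisB n b' := by
    rw [Finset.sum_mul_sum, ← Finset.sum_product']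
    refine Finset.sum_congr rfl fun x _ => ?_
    simp only [partialTranspose, pureProj, Matrix.vecMulVec_apply, Matrix.of_apply, ket,
      Pi.star_apply]
    ring
  rw [this, hA, sum_star_mul_basisB, Pi.smul_apply, smul_eq_mul, ket, Complex.ofReal_mul]
  ring

/-- The basis of eigenvectors of the partially transposed projector: `|kk⟩`, and `|ψ⁻⟩` or `|ψ⁺⟩`
for unequal indices in increasing or decreasing order. -/
noncomputable def eigenvec (q : Fin d × Fin d) : Fin d × Fin d → ℂ :=
  if q.1 = q.2 then S.ket q.1 q.2 else if q.1 < q.2 then S.psiMinus q.1 q.2 else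
    ((Real.sqrt 2 : ℝ) : ℂ)⁻¹ • (S.ket q.1 q.2 + S.ket q.2 q.1)

/-- The eigenvalue of the partially transposed projector at `eigenvec`. -/
def eigenval (q : Fin d × Fin d) : ℝ :=
  if q.1 < q.2 then -(S.coeff q.1 * S.coeff q.2) else S.coeff q.1 * S.coeff q.2

theorem psiMinus_eq (m n : Fin d) :
    S.psiMinus m n = ((Real.sqrt 2 : ℝ) : ℂ)⁻¹ • (S.ket m n - S.ket n m) := by
  ext x
  rw [psiMinus, div_eq_inv_mul]
  rfl

theorem partialTranspose_pureProj_mulVec_psiMinus (m n : Fin d) :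
    partialTranspose (pureProj ψ) *ᵥ S.psiMinus m n
      = ((-(S.coeff m * S.coeff n) : ℝ) : ℂ) • S.psiMinus m n := by
  rw [psiMinus_eq, Matrix.mulVec_smul, Matrix.mulVec_sub, partialTranspose_pureProj_mulVec_ket,
    partialTranspose_pureProj_mulVec_ket, mul_comm (S.coeff n), ← smul_sub, smul_comm,
    Complex.ofReal_neg, neg_smul, ← smul_neg, ← smul_neg, neg_sub]

theorem eigenvec_of_lt {m n : Fin d} (h : m < n) : S.eigenvec (m, n) = S.psiMinus m n := by
  simp only [eigenvec, h.ne, h, if_true, if_false]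

theorem eigenvec_of_eq {m n : Fin d} (h : m = n) : S.eigenvec (m, n) = S.ket m n := by
  simp only [eigenvec, h, if_true]

theorem eigenvec_of_gt {m n : Fin d} (h : n < m) :
    S.eigenvec (m, n) = ((Real.sqrt 2 : ℝ) : ℂ)⁻¹ • (S.ket m n + S.ket n m) := by
  simp only [eigenvec, h.ne', h.not_gt, if_false]

theorem partialTranspose_pureProj_mulVec_eigenvec (q : Fin d × Fin d) :
    partialTranspose (pureProj ψ) *ᵥ S.eigenvec q = (S.eigenval q : ℂ) • S.eigenvec q := by
  obtain ⟨m, n⟩ := q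
  rcases lt_trichotomy m n with h | h | h
  · rw [S.eigenvec_of_lt h, eigenval, if_pos h]
    exact S.partialTranspose_pureProj_mulVec_psiMinus m n
  · subst h
    rw [S.eigenvec_of_eq rfl, eigenval, if_neg (lt_irrefl _)]
    exact S.partialTranspose_pureProj_mulVec_ket m m
  · rw [S.eigenvec_of_gt h, eigenval, if_neg h.not_gt, Matrix.mulVec_smul, Matrix.mulVec_add,
      partialTranspose_pureProj_mulVec_ket, partialTranspose_pureProj_mulVec_ket,
      mul_comm (S.coeff n), ← smul_add, smul_comm, add_comm (S.ket n m)]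

theorem inv_sqrt_two_mul_self :
    ((Real.sqrt 2 : ℝ) : ℂ)⁻¹ * ((Real.sqrt 2 : ℝ) : ℂ)⁻¹ = 1 / 2 := by
  rw [← mul_inv, ← Complex.ofReal_mul, Real.mul_self_sqrt (by norm_num)]
  norm_num

theorem star_inv_sqrt_two : star ((Real.sqrt 2 : ℝ) : ℂ)⁻¹ = ((Real.sqrt 2 : ℝ) : ℂ)⁻¹ := by
  rw [star_inv₀, Complex.star_def, Complex.conj_ofReal]

theorem star_psiMinus_dotProduct_self {m n : Fin d} (h : m ≠ n) :
    star (S.psiMinus m n) ⬝ᵥ S.psiMinus m n = 1 := by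
  rw [psiMinus_eq, star_smul, star_sub, smul_dotProduct, dotProduct_smul, star_inv_sqrt_two,
    smul_smul, inv_sqrt_two_mul_self]
  simp only [sub_dotProduct, dotProduct_sub, star_ket_dotProduct, h, h.symm, if_true, if_false,
    smul_eq_mul]
  norm_num

/-- The two orders of an unordered pair use the same kets with opposite relative signs, hence are
orthogonal; all other cases reduce to deltas between kets. -/
theorem star_eigenvec_dotProduct (q q' : Fin d × Fin d) :
    star (S.eigenvec q) ⬝ᵥ S.eigenvec q' = if q = q' then 1 else 0 := by
  obtain ⟨m, n⟩ := q
  obtain ⟨m', n'⟩ := q'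
  have h2 := inv_sqrt_two_mul_self
  rcases lt_trichotomy m n with h | h | h <;>
  (first | rw [S.eigenvec_of_lt h] | rw [S.eigenvec_of_eq h] | rw [S.eigenvec_of_gt h]) <;>
  rcases lt_trichotomy m' n' with h' | h' | h' <;>
  (first | rw [S.eigenvec_of_lt h'] | rw [S.eigenvec_of_eq h'] | rw [S.eigenvec_of_gt h']) <;>
  simp only [psiMinus_eq, star_smul, star_sub, star_add, smul_dotProduct, dotProduct_smul,
    star_inv_sqrt_two, sub_dotProduct, dotProduct_sub, add_dotProduct, dotProduct_add,
    star_ket_dotProduct, Prod.mk.injEq, smul_eq_mul, mul_ite, mul_one, mul_zero] <;>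
  grind

end SchmidtDecomposition

/-! ### Minimizing a multi-affine form over a box -/

section Minimum

variable {ι : Type*} [Fintype ι] [DecidableEq ι] {a b : ι → ℝ} {c p : ℝ}

/-- The common form `c ∏ (1 - xᵢ) + p ∏ xᵢ` of all the eigenvalues. -/
def mixedProd (c p : ℝ) (x : ι → ℝ) : ℝ :=
  c * ∏ i, (1 - x i) + p * ∏ i, x i

theorem mixedProd_update (x : ι → ℝ) (j : ι) (t : ℝ) :
    mixedProd c p (Function.update x j t)
      = c * ((1 - t) * ∏ i ∈ Finset.univ.erase j, (1 - x i))
        + p * (t * ∏ i ∈ Finset.univ.erase j, x i) := by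
  have h (f : ι → ℝ → ℝ) : ∏ i, f i (Function.update x j t i)
      = f j t * ∏ i ∈ Finset.univ.erase j, f i (x i) := by
    rw [← Finset.mul_prod_erase _ _ (Finset.mem_univ j), Function.update_self]
    congr 1
    refine Finset.prod_congr rfl fun i hi => ?_
    rw [Function.update_of_ne (Finset.ne_of_mem_erase hi)]
  rw [mixedProd, h fun _ s => 1 - s, h fun _ s => s]

/-- An affine function on an interval is bounded below by its smaller value at the end points. -/
theorem min_le_of_affine {r s l u t : ℝ} (hl : l ≤ t) (hu : t ≤ u) :
    min (r + s * l) (r + s * u) ≤ r + s * t := by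
  rcases le_total 0 s with hs | hs
  · exact (min_le_left _ _).trans (by gcongr)
  · exact (min_le_right _ _).trans (by linarith [mul_le_mul_of_nonpos_left hu hs])

theorem min_mixedProd_update_le (x : ι → ℝ) (j : ι) {l u : ℝ} (hl : l ≤ x j) (hu : x j ≤ u) :
    min (mixedProd c p (Function.update x j l)) (mixedProd c p (Function.update x j u))
      ≤ mixedProd c p x := by
  have key (t : ℝ) : mixedProd c p (Function.update x j t)
      = c * ∏ i ∈ Finset.univ.erase j, (1 - x i)
        + (p * ∏ i ∈ Finset.univ.erase j, x i - c * ∏ i ∈ Finset.univ.erase j, (1 - x i)) * t := by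
    rw [mixedProd_update]
    ring
  conv_rhs => rw [← Function.update_eq_self j x]
  rw [key, key, key]
  exact min_le_of_affine hl hu

/-- If one coordinate takes its negative extreme value, moving all the others to their positive
extreme values decreases the form. -/
theorem mixedProd_update_neg_le (hc : 0 ≤ c) (hp : 0 ≤ p) (hb : ∀ i, 0 ≤ b i)
    (hba : ∀ i, b i ≤ a i) (ha : ∀ i, a i ≤ 1) {x : ι → ℝ} (hl : ∀ i, -b i ≤ x i)
    (hu : ∀ i, x i ≤ a i) (j : ι) :
    mixedProd c p (Function.update a j (-b j)) ≤ mixedProd c p (Function.update x j (-b j)) := by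
  rw [mixedProd_update, mixedProd_update]
  have h1 : ∏ i ∈ Finset.univ.erase j, (1 - a i) ≤ ∏ i ∈ Finset.univ.erase j, (1 - x i) :=
    Finset.prod_le_prod (fun i _ => by linarith [ha i]) fun i _ => by linarith [hu i]
  -- The `x i` may be negative, so absolute values are compared: `b i ≤ a i` gives `|x i| ≤ a i`.
  have h2 : ∏ i ∈ Finset.univ.erase j, x i ≤ ∏ i ∈ Finset.univ.erase j, a i := by
    refine (le_abs_self _).trans ?_
    rw [Finset.abs_prod]
    exact Finset.prod_le_prod (fun i _ => abs_nonneg _) fun i _ =>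
      abs_le.mpr ⟨by linarith [hl i, hba i], hu i⟩
  have h3 := hb j
  have h4 : c * ((1 - -b j) * ∏ i ∈ Finset.univ.erase j, (1 - a i))
      ≤ c * ((1 - -b j) * ∏ i ∈ Finset.univ.erase j, (1 - x i)) :=
    mul_le_mul_of_nonneg_left (mul_le_mul_of_nonneg_left h1 (by linarith)) hc
  have h5 : p * (-b j * ∏ i ∈ Finset.univ.erase j, a i)
      ≤ p * (-b j * ∏ i ∈ Finset.univ.erase j, x i) :=
    mul_le_mul_of_nonneg_left (mul_le_mul_of_nonpos_left h2 (by linarith)) hp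
  linarith

/-- The minimum of the form over a box is attained where at most one coordinate takes its negative
extreme value. -/
theorem le_mixedProd_of_mem_box (hc : 0 ≤ c) (hp : 0 ≤ p) (hb : ∀ i, 0 ≤ b i)
    (hba : ∀ i, b i ≤ a i) (ha : ∀ i, a i ≤ 1) {m : ℝ} (h0 : m ≤ mixedProd c p a)
    (h1 : ∀ j, m ≤ mixedProd c p (Function.update a j (-b j))) {x : ι → ℝ}
    (hl : ∀ i, -b i ≤ x i) (hu : ∀ i, x i ≤ a i) : m ≤ mixedProd c p x := by
  -- Induction on the set `s` of coordinates allowed to differ from `a`. Pushing one of them to an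
  -- end point of its interval gives either the case of the preceding lemma or a smaller `s`.
  suffices ∀ (s : Finset ι) (x : ι → ℝ), (∀ i, -b i ≤ x i) → (∀ i, x i ≤ a i) →
      (∀ i ∉ s, x i = a i) → m ≤ mixedProd c p x from
    this Finset.univ x hl hu fun i hi => absurd (Finset.mem_univ i) hi
  intro s
  induction s using Finset.induction_on with
  | empty =>
    intro x _ _ hx
    rwa [show x = a from funext fun i => hx i (Finset.notMem_empty i)]
  | insert j s _ ih =>
    intro x hl hu hx
    refine le_trans (le_min ?_ ?_) (min_mixedProd_update_le x j (hl j) (hu j))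
    · exact (h1 j).trans (mixedProd_update_neg_le hc hp hb hba ha hl hu j)
    · refine ih _ (fun i => ?_) (fun i => ?_) fun i hi => ?_
      · rcases eq_or_ne i j with rfl | hij
        · rw [Function.update_self]
          linarith [hl i, hu i]
        · rw [Function.update_of_ne hij]
          exact hl i
      · rcases eq_or_ne i j with rfl | hij
        · rw [Function.update_self]
        · rw [Function.update_of_ne hij]
          exact hu i
      · rcases eq_or_ne i j with rfl | hij
        · rw [Function.update_self]
        · rw [Function.update_of_ne hij]
          exact hx i (by simp [hij, hi])

end Minimum

/-! ### Product eigenvectors of the global partial transpose -/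

section Main

variable {M : ℕ} {d : Fin M → ℕ} {ψ : ∀ i, Fin (d i) × Fin (d i) → ℂ} {p : ℝ}

theorem partialTranspose_rhoP (ψ : ∀ i, Fin (d i) × Fin (d i) → ℂ) (p : ℝ) :
    partialTranspose (rhoP ψ p) =
      ((1 - p : ℝ) : ℂ) • localTensor (fun i => ((1 / ((d i : ℝ) ^ 2 - 1) : ℝ) : ℂ) •
        (1 - partialTranspose (pureProj (ψ i))))
      + (p : ℂ) • localTensor (fun i => partialTranspose (pureProj (ψ i))) := by
  simp only [rhoP, partialTranspose_add, partialTranspose_smul, partialTranspose_localTensor,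
    partialTranspose_sub, partialTranspose_one]

/-- Tensor products of local eigenvectors are eigenvectors of the partial transpose. -/
theorem partialTranspose_rhoP_mulVec {v : ∀ i, Fin (d i) × Fin (d i) → ℂ} {x : Fin M → ℝ}
    (h : ∀ i, partialTranspose (pureProj (ψ i)) *ᵥ v i = (x i : ℂ) • v i) :
    partialTranspose (rhoP ψ p) *ᵥ localTensorVec v
      = ((mixedProd ((1 - p) * normFactor d) p x : ℝ) : ℂ) • localTensorVec v := by
  have h1 (i) : (((1 / ((d i : ℝ) ^ 2 - 1) : ℝ) : ℂ) • (1 - partialTranspose (pureProj (ψ i))))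
      *ᵥ v i = ((1 / ((d i : ℝ) ^ 2 - 1) * (1 - x i) : ℝ) : ℂ) • v i := by
    rw [Matrix.smul_mulVec, Matrix.sub_mulVec, Matrix.one_mulVec, h, Complex.ofReal_mul, mul_smul,
      Complex.ofReal_sub, sub_smul, Complex.ofReal_one, one_smul]
  rw [partialTranspose_rhoP, Matrix.add_mulVec, Matrix.smul_mulVec, Matrix.smul_mulVec,
    localTensor_mulVec, localTensor_mulVec]
  simp only [h, h1]
  rw [localTensorVec_smul, localTensorVec_smul, smul_smul, smul_smul, ← add_smul, mixedProd,
    normFactor, mul_assoc (1 - p), ← Finset.prod_mul_distrib]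
  push_cast
  rfl

theorem pairEigenvalue_eq (μ : ∀ i, Fin (d i) → ℝ) (p : ℝ) (j : Fin M) (k : ∀ i, Fin (d i))
    (m n : Fin (d j)) :
    pairEigenvalue μ p j k m n = mixedProd ((1 - p) * normFactor d) p
      (Function.update (fun i => μ i (k i) ^ 2) j (-(μ j m * μ j n))) := by
  rw [mixedProd_update, pairEigenvalue]
  ring

variable (S : ∀ i, SchmidtDecomposition (ψ i))

theorem star_pairVector_dotProduct_self (j : Fin M) (k : ∀ i, Fin (d i)) {m n : Fin (d j)}
    (h : m ≠ n) : star (pairVector S j k m n) ⬝ᵥ pairVector S j k m n = 1 := by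
  rw [pairVector, star_localTensorVec_dotProduct]
  refine Finset.prod_eq_one fun i _ => ?_
  rcases eq_or_ne i j with rfl | hij
  · rw [Function.update_self, SchmidtDecomposition.star_psiMinus_dotProduct_self _ h]
  · simp [Function.update_of_ne hij, SchmidtDecomposition.star_ket_dotProduct]

theorem partialTranspose_rhoP_mulVec_pairVector (j : Fin M) (k : ∀ i, Fin (d i))
    (m n : Fin (d j)) :
    partialTranspose (rhoP ψ p) *ᵥ pairVector S j k m n =
      ((pairEigenvalue (fun i => (S i).coeff) p j k m n : ℝ) : ℂ) • pairVector S j k m n := by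
  rw [pairEigenvalue_eq]
  refine partialTranspose_rhoP_mulVec fun i => ?_
  rcases eq_or_ne i j with rfl | hij
  · rw [Function.update_self, Function.update_self]
    exact (S i).partialTranspose_pureProj_mulVec_psiMinus m n
  · rw [Function.update_of_ne hij, Function.update_of_ne hij, sq]
    exact (S i).partialTranspose_pureProj_mulVec_ket (k i) (k i)

/-- Products of members of orthonormal families are orthonormal. -/
theorem star_prod_dotProduct {ι : Type*} [Fintype ι] [DecidableEq ι] {α κ : ι → Type*}
    [∀ i, Fintype (α i)] [∀ i, DecidableEq (κ i)] (f : ∀ i, κ i → α i → ℂ)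
    (hf : ∀ i r s, ∑ a, star (f i r a) * f i s a = if r = s then 1 else 0) (r s : ∀ i, κ i) :
    star (fun a : ∀ i, α i => ∏ i, f i (r i) (a i)) ⬝ᵥ (fun a => ∏ i, f i (s i) (a i))
      = if r = s then 1 else 0 := by
  simp only [dotProduct, Pi.star_apply, star_prod, ← Finset.prod_mul_distrib]
  rw [← Fintype.prod_sum fun i a => star (f i (r i) a) * f i (s i) a]
  simp only [hf]
  rw [Finset.prod_boole]
  simp [funext_iff]

/-- The factors `|kᵢkᵢ⟩` are product vectors, so the two terms of `ψ⁻` on pair `j` stay the only two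
terms. On each side they differ at site `j`, hence are orthonormal. -/
theorem schmidtRank_pairVector (j : Fin M) (k : ∀ i, Fin (d i)) {m n : Fin (d j)} (h : m ≠ n) :
    schmidtRank (pairVector S j k m n) = 2 := by
  set r : Fin 2 → ∀ i, Fin (d i) := ![Function.update k j m, Function.update k j n]
  set t : Fin 2 → ∀ i, Fin (d i) := ![Function.update k j n, Function.update k j m]
  have hr : Function.Injective r := by
    have : Function.update k j m ≠ Function.update k j n := fun e =>
      h (by simpa using congrFun e j)
    intro x y hxy
    fin_cases x <;> fin_cases y <;> simp_all [r]
  have ht : Function.Injective t := by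
    have : Function.update k j n ≠ Function.update k j m := fun e =>
      h (by simpa using (congrFun e j).symm)
    intro x y hxy
    fin_cases x <;> fin_cases y <;> simp_all [t]
  have hs : ((Real.sqrt 2 : ℝ) : ℂ)⁻¹ ≠ 0 := by simp
  refine schmidtRank_eq_two (u := fun s a => ∏ i, star ((S i).basisA (r s i) (a i)))
    (v := fun s b => ∏ i, (S i).basisB (t s i) (b i))
    (c := ![((Real.sqrt 2 : ℝ) : ℂ)⁻¹, -((Real.sqrt 2 : ℝ) : ℂ)⁻¹]) (fun s => ?_) (fun x y => ?_)
    (fun x y => ?_) fun a b => ?_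
  · fin_cases s
    · exact hs
    · exact neg_ne_zero.mpr hs
  · rw [star_prod_dotProduct (fun i κ a => star ((S i).basisA κ a)) (fun i κ κ' => ?_)]
    · exact if_congr hr.eq_iff rfl rfl
    · rw [← if_congr (eq_comm (a := κ') (b := κ)) rfl rfl, ← (S i).star_basisA_dotProduct]
      exact Finset.sum_congr rfl fun a _ => by rw [star_star, mul_comm]
  · rw [star_prod_dotProduct (fun i κ b => (S i).basisB κ b)
      fun i κ κ' => (S i).star_basisB_dotProduct κ κ']
    exact if_congr ht.eq_iff rfl rfl
  · have key (m' n' : Fin (d j)) :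
        (∏ i, star ((S i).basisA (Function.update k j m' i) (a i))) *
            ∏ i, (S i).basisB (Function.update k j n' i) (b i)
          = (S j).ket m' n' (a j, b j) *
            ∏ i ∈ Finset.univ.erase j, (S i).ket (k i) (k i) (a i, b i) := by
      rw [← Finset.prod_mul_distrib, ← Finset.mul_prod_erase _ _ (Finset.mem_univ j),
        Function.update_self, Function.update_self]
      congr 1
      refine Finset.prod_congr rfl fun i hi => ?_
      rw [Function.update_of_ne (Finset.ne_of_mem_erase hi),
        Function.update_of_ne (Finset.ne_of_mem_erase hi)]
      rfl
    rw [Fin.sum_univ_two]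
    simp only [r, t, Matrix.cons_val_zero, Matrix.cons_val_one]
    rw [key, key, pairVector, localTensorVec, ← Finset.mul_prod_erase _ _ (Finset.mem_univ j),
      Function.update_self, SchmidtDecomposition.psiMinus]
    have : ∏ i ∈ Finset.univ.erase j, (Function.update (fun i => (S i).ket (k i) (k i)) j
          ((S j).psiMinus m n)) i (a i, b i)
        = ∏ i ∈ Finset.univ.erase j, (S i).ket (k i) (k i) (a i, b i) :=
      Finset.prod_congr rfl fun i hi => by rw [Function.update_of_ne (Finset.ne_of_mem_erase hi)]
    rw [this]
    ring

/-- The eigenvalues of the partial transpose, indexed by the product eigenbasis. -/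
noncomputable def rhoEigenvalue (S : ∀ i, SchmidtDecomposition (ψ i)) (p : ℝ)
    (q : (∀ i, Fin (d i)) × (∀ i, Fin (d i))) : ℝ :=
  mixedProd ((1 - p) * normFactor d) p fun i => (S i).eigenval (q.1 i, q.2 i)

theorem star_localTensorVec_eigenvec_dotProduct (q q' : (∀ i, Fin (d i)) × (∀ i, Fin (d i))) :
    star (localTensorVec fun i => (S i).eigenvec (q.1 i, q.2 i)) ⬝ᵥ
      localTensorVec (fun i => (S i).eigenvec (q'.1 i, q'.2 i)) = if q = q' then 1 else 0 := by
  rw [star_localTensorVec_dotProduct]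
  simp only [SchmidtDecomposition.star_eigenvec_dotProduct]
  rw [Finset.prod_boole]
  simp [Prod.ext_iff, funext_iff, forall_and]

theorem spectrum_partialTranspose_rhoP :
    spectrum ℝ (partialTranspose (rhoP ψ p)) = Set.range (rhoEigenvalue S p) :=
  spectrum_eq_range_of_eigenbasis (star_localTensorVec_eigenvec_dotProduct S) fun _ =>
    partialTranspose_rhoP_mulVec fun i => (S i).partialTranspose_pureProj_mulVec_eigenvec _

theorem isPPT_rhoP_iff : IsPPT (rhoP ψ p) ↔ ∀ q, 0 ≤ rhoEigenvalue S p q :=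
  posSemidef_iff_of_eigenbasis (star_localTensorVec_eigenvec_dotProduct S) fun _ =>
    partialTranspose_rhoP_mulVec fun i => (S i).partialTranspose_pureProj_mulVec_eigenvec _

theorem normFactor_pos (hd : ∀ i, 2 ≤ d i) : 0 < normFactor d :=
  Finset.prod_pos fun i _ => by
    have : (2 : ℝ) ≤ d i := by exact_mod_cast hd i
    exact one_div_pos.mpr (by nlinarith)

end Main

/-! ### Bounds on the local eigenvalues -/

namespace SchmidtDecomposition

variable {d : ℕ} {ψ : Fin d × Fin d → ℂ} (S : SchmidtDecomposition ψ) {k l : Fin d}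

theorem coeff_sq_le_one (hψ : star ψ ⬝ᵥ ψ = 1) (j : Fin d) : S.coeff j ^ 2 ≤ 1 := by
  rw [← S.sum_coeff_sq hψ]
  exact Finset.single_le_sum (f := fun j => S.coeff j ^ 2) (fun _ _ => sq_nonneg _)
    (Finset.mem_univ j)

theorem coeff_mul_le_sq (hk : (k : ℕ) = 0) (m n : Fin d) :
    S.coeff m * S.coeff n ≤ S.coeff k ^ 2 := by
  have h (j : Fin d) : S.coeff j ≤ S.coeff k :=
    S.coeff_antitone (Fin.le_def.mpr (by omega))
  rw [sq]
  exact mul_le_mul (h m) (h n) (S.coeff_nonneg n) (S.coeff_nonneg k)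

/-- Since `m < n`, the index `n` is at least 1, so `μ_n` is at most the second coefficient. -/
theorem coeff_mul_le_of_lt (hk : (k : ℕ) = 0) (hl : (l : ℕ) = 1) {m n : Fin d} (h : m < n) :
    S.coeff m * S.coeff n ≤ S.coeff k * S.coeff l :=
  mul_le_mul (S.coeff_antitone (Fin.le_def.mpr (by omega)))
    (S.coeff_antitone (Fin.le_def.mpr (by have := Fin.lt_def.mp h; omega)))
    (S.coeff_nonneg n) (S.coeff_nonneg k)

theorem eigenval_le (hk : (k : ℕ) = 0) (q : Fin d × Fin d) : S.eigenval q ≤ S.coeff k ^ 2 := by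
  have h0 := mul_nonneg (S.coeff_nonneg q.1) (S.coeff_nonneg q.2)
  have h1 := S.coeff_mul_le_sq hk q.1 q.2
  unfold eigenval
  split_ifs <;> linarith

theorem neg_le_eigenval (hk : (k : ℕ) = 0) (hl : (l : ℕ) = 1) (q : Fin d × Fin d) :
    -(S.coeff k * S.coeff l) ≤ S.eigenval q := by
  have h0 := mul_nonneg (S.coeff_nonneg q.1) (S.coeff_nonneg q.2)
  have h1 := mul_nonneg (S.coeff_nonneg k) (S.coeff_nonneg l)
  unfold eigenval
  split_ifs with h
  · exact neg_le_neg (S.coeff_mul_le_of_lt hk hl h)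
  · linarith

end SchmidtDecomposition

/-! ### Smallest eigenvalue, PPT criterion and distillability -/

section Main

variable {M : ℕ} {d : Fin M → ℕ} {ψ : ∀ i, Fin (d i) × Fin (d i) → ℂ} {p : ℝ}
  (S : ∀ i, SchmidtDecomposition (ψ i)) {fst snd : ∀ i, Fin (d i)}

theorem rhoEigenvalue_fst :
    rhoEigenvalue S p (fst, fst)
      = mixedProd ((1 - p) * normFactor d) p fun i => (S i).coeff (fst i) ^ 2 := by
  unfold rhoEigenvalue
  congr 1
  ext i
  simp [SchmidtDecomposition.eigenval, sq]

/-- Shows that `Λ_j` is attained: the index pair at site `j` is increasing and so selects `ψ⁻`,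
while all other sites carry `|11⟩`. -/
theorem rhoEigenvalue_update (hfst : ∀ i, (fst i : ℕ) = 0) (hsnd : ∀ i, (snd i : ℕ) = 1)
    (j : Fin M) :
    rhoEigenvalue S p (fst, Function.update fst j (snd j))
      = pairEigenvalue (fun i => (S i).coeff) p j fst (fst j) (snd j) := by
  rw [pairEigenvalue_eq, rhoEigenvalue]
  congr 1
  ext i
  rcases eq_or_ne i j with rfl | hij
  · simp [SchmidtDecomposition.eigenval, Fin.lt_def, hfst, hsnd]
  · simp [Function.update_of_ne hij, SchmidtDecomposition.eigenval, sq]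

theorem le_rhoEigenvalue (hd : ∀ i, 2 ≤ d i) (hψ : ∀ i, star (ψ i) ⬝ᵥ ψ i = 1) (hp0 : 0 ≤ p)
    (hp1 : p ≤ 1) (hfst : ∀ i, (fst i : ℕ) = 0) (hsnd : ∀ i, (snd i : ℕ) = 1) {t : ℝ}
    (h0 : t ≤ mixedProd ((1 - p) * normFactor d) p fun i => (S i).coeff (fst i) ^ 2)
    (h1 : ∀ j, t ≤ pairEigenvalue (fun i => (S i).coeff) p j fst (fst j) (snd j))
    (q : (∀ i, Fin (d i)) × (∀ i, Fin (d i))) : t ≤ rhoEigenvalue S p q := by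
  refine le_mixedProd_of_mem_box (b := fun i => (S i).coeff (fst i) * (S i).coeff (snd i))
    (mul_nonneg (by linarith) (normFactor_pos hd).le) hp0
    (fun i => mul_nonneg ((S i).coeff_nonneg _) ((S i).coeff_nonneg _))
    (fun i => (S i).coeff_mul_le_sq (hfst i) _ _) (fun i => (S i).coeff_sq_le_one (hψ i) _) h0
    (fun j => ?_) (fun i => (S i).neg_le_eigenval (hfst i) (hsnd i) _)
    (fun i => (S i).eigenval_le (hfst i) _)
  have := h1 j
  rwa [pairEigenvalue_eq] at this

/-- The corner `a` of the box never yields a negative eigenvalue, so failure of PPT is decided by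
the `Λ_j` alone. -/
theorem mixedProd_coeff_nonneg (hd : ∀ i, 2 ≤ d i) (hψ : ∀ i, star (ψ i) ⬝ᵥ ψ i = 1)
    (hp0 : 0 ≤ p) (hp1 : p ≤ 1) :
    0 ≤ mixedProd ((1 - p) * normFactor d) p fun i => (S i).coeff (fst i) ^ 2 :=
  add_nonneg
    (mul_nonneg (mul_nonneg (by linarith) (normFactor_pos hd).le)
      (Finset.prod_nonneg fun i _ => sub_nonneg.mpr ((S i).coeff_sq_le_one (hψ i) _)))
    (mul_nonneg hp0 (Finset.prod_nonneg fun i _ => sq_nonneg _))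

theorem isLeast_spectrum (hM : 1 ≤ M) (hd : ∀ i, 2 ≤ d i) (hψ : ∀ i, star (ψ i) ⬝ᵥ ψ i = 1)
    (hp0 : 0 ≤ p) (hp1 : p ≤ 1) (hfst : ∀ i, (fst i : ℕ) = 0) (hsnd : ∀ i, (snd i : ℕ) = 1) :
    IsLeast (spectrum ℝ (partialTranspose (rhoP ψ p)))
      (min (mixedProd ((1 - p) * normFactor d) p fun i => (S i).coeff (fst i) ^ 2)
        (⨅ j : Fin M, pairEigenvalue (fun i => (S i).coeff) p j fst (fst j) (snd j))) := by
  have : Nonempty (Fin M) := ⟨⟨0, hM⟩⟩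
  rw [spectrum_partialTranspose_rhoP S]
  constructor
  · rcases min_choice (mixedProd ((1 - p) * normFactor d) p fun i => (S i).coeff (fst i) ^ 2)
      (⨅ j : Fin M, pairEigenvalue (fun i => (S i).coeff) p j fst (fst j) (snd j)) with h | h
    · rw [h]
      exact ⟨_, rhoEigenvalue_fst S⟩
    · rw [h]
      obtain ⟨j, hj⟩ := exists_eq_ciInf_of_finite
        (f := fun j : Fin M => pairEigenvalue (fun i => (S i).coeff) p j fst (fst j) (snd j))
      rw [← hj]
      exact ⟨_, rhoEigenvalue_update S hfst hsnd j⟩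
  · rintro _ ⟨q, rfl⟩
    exact le_rhoEigenvalue S hd hψ hp0 hp1 hfst hsnd (min_le_left _ _)
      (fun j => (min_le_right _ _).trans (ciInf_le (Set.finite_range _).bddBelow j)) q

theorem isPPT_rhoP_iff_pairEigenvalue (hd : ∀ i, 2 ≤ d i) (hψ : ∀ i, star (ψ i) ⬝ᵥ ψ i = 1)
    (hp0 : 0 ≤ p) (hp1 : p ≤ 1) (hfst : ∀ i, (fst i : ℕ) = 0) (hsnd : ∀ i, (snd i : ℕ) = 1) :
    IsPPT (rhoP ψ p) ↔
      ∀ j, 0 ≤ pairEigenvalue (fun i => (S i).coeff) p j fst (fst j) (snd j) := by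
  rw [isPPT_rhoP_iff S]
  refine ⟨fun h j => ?_, fun h => le_rhoEigenvalue S hd hψ hp0 hp1 hfst hsnd
    (mixedProd_coeff_nonneg S hd hψ hp0 hp1) h⟩
  rw [← rhoEigenvalue_update S hfst hsnd]
  exact h _

theorem fst_ne_snd (hfst : ∀ i, (fst i : ℕ) = 0) (hsnd : ∀ i, (snd i : ℕ) = 1) (j : Fin M) :
    fst j ≠ snd j := fun h => by
  have := congrArg Fin.val h
  rw [hfst, hsnd] at this
  exact zero_ne_one this

theorem isCopyDistillable_one_of_isNPT (hd : ∀ i, 2 ≤ d i)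
    (hψ : ∀ i, star (ψ i) ⬝ᵥ ψ i = 1) (hp0 : 0 ≤ p) (hp1 : p ≤ 1) (h : IsNPT (rhoP ψ p)) :
    IsCopyDistillable 1 (rhoP ψ p) := by
  have S i := (nonempty_schmidtDecomposition (ψ i)).some
  set fst : ∀ i, Fin (d i) := fun i => ⟨0, by have := hd i; omega⟩
  set snd : ∀ i, Fin (d i) := fun i => ⟨1, hd i⟩
  have hfst i : (fst i : ℕ) = 0 := rfl
  have hsnd i : (snd i : ℕ) = 1 := rfl
  rw [IsNPT, isPPT_rhoP_iff_pairEigenvalue S hd hψ hp0 hp1 hfst hsnd] at h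
  push Not at h
  obtain ⟨j, hj⟩ := h
  have hne := fst_ne_snd hfst hsnd j
  refine isCopyDistillable_one (star_pairVector_dotProduct_self S j fst hne)
    (schmidtRank_pairVector S j fst hne) ?_
  rw [partialTranspose_rhoP_mulVec_pairVector, dotProduct_smul,
    star_pairVector_dotProduct_self S j fst hne, smul_eq_mul, mul_one, Complex.ofReal_re]
  exact hj

end Main

theorem mainTheorem5 (M : ℕ) (hM : 1 ≤ M) (d : Fin M → ℕ) (hd : ∀ i, 2 ≤ d i)
    (ψ : ∀ i, Fin (d i) × Fin (d i) → ℂ) (hψ : ∀ i, star (ψ i) ⬝ᵥ ψ i = 1)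
    (p : ℝ) (hp0 : 0 ≤ p) (hp1 : p ≤ 1) :
    -- NPT implies 1-copy distillable; no NPT bound entanglement
    (IsNPT (rhoP ψ p) → IsCopyDistillable 1 (rhoP ψ p) ∧ IsDistillable (rhoP ψ p)) ∧
    ¬ IsNPTBoundEntangled (rhoP ψ p) ∧
    ∀ (S : ∀ i, SchmidtDecomposition (ψ i))
      -- `fst`, `snd`: the indices of the two largest Schmidt coefficients of each state
      (fst snd : ∀ i, Fin (d i)), (∀ i, (fst i : ℕ) = 0) → (∀ i, (snd i : ℕ) = 1) →
      -- the Schmidt-rank-2 eigenvectors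
      (∀ (j : Fin M) (k : ∀ i, Fin (d i)) (m n : Fin (d j)), m ≠ n →
        star (pairVector S j k m n) ⬝ᵥ pairVector S j k m n = 1 ∧
        schmidtRank (pairVector S j k m n) = 2 ∧
        partialTranspose (rhoP ψ p) *ᵥ pairVector S j k m n =
          ((pairEigenvalue (fun i => (S i).coeff) p j k m n : ℝ) : ℂ) • pairVector S j k m n) ∧
      -- the smallest eigenvalue when the state is NPT
      (IsNPT (rhoP ψ p) → ∃ j : Fin M,
        IsLeast (spectrum ℝ (partialTranspose (rhoP ψ p)))
          (pairEigenvalue (fun i => (S i).coeff) p j fst (fst j) (snd j))) ∧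
      -- the smallest eigenvalue in general
      IsLeast (spectrum ℝ (partialTranspose (rhoP ψ p)))
        (min ((1 - p) * normFactor d * (∏ i, (1 - (S i).coeff (fst i) ^ 2))
              + p * ∏ i, (S i).coeff (fst i) ^ 2)
          (⨅ j : Fin M, pairEigenvalue (fun i => (S i).coeff) p j fst (fst j) (snd j))) ∧
      -- the PPT condition, free of divisions
      (IsPPT (rhoP ψ p) ↔ ∀ j : Fin M,
        p * ((∏ i ∈ Finset.univ.erase j, (S i).coeff (fst i) ^ 2)
            * ((S j).coeff (fst j) * (S j).coeff (snd j)))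
          ≤ (1 - p) * normFactor d * ((∏ i ∈ Finset.univ.erase j, (1 - (S i).coeff (fst i) ^ 2))
            * (1 + (S j).coeff (fst j) * (S j).coeff (snd j)))) ∧
      -- the PPT condition as a bound on `p`, when every state is entangled
      (p < 1 → (∀ i, 0 < (S i).coeff (snd i)) →
        (IsPPT (rhoP ψ p) ↔
          p / ((1 - p) * normFactor d) ≤
            ⨅ j : Fin M,
              ((∏ i ∈ Finset.univ.erase j, (1 - (S i).coeff (fst i) ^ 2))
                * (1 + (S j).coeff (fst j) * (S j).coeff (snd j)))
              / ((∏ i ∈ Finset.univ.erase j, (S i).coeff (fst i) ^ 2)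
                * ((S j).coeff (fst j) * (S j).coeff (snd j))))) := by
  have hdist : IsNPT (rhoP ψ p) → IsCopyDistillable 1 (rhoP ψ p) ∧ IsDistillable (rhoP ψ p) :=
    fun h =>
      have h' := isCopyDistillable_one_of_isNPT hd hψ hp0 hp1 h
      ⟨h', 1, le_rfl, h'⟩
  refine ⟨hdist, fun h => h.2 (hdist h.1).2, fun S fst snd hfst hsnd => ?_⟩
  have : Nonempty (Fin M) := ⟨⟨0, hM⟩⟩
  have hleast := isLeast_spectrum S hM hd hψ hp0 hp1 hfst hsnd
  have hppt := isPPT_rhoP_iff_pairEigenvalue S hd hψ hp0 hp1 hfst hsnd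
  have hppt' : IsPPT (rhoP ψ p) ↔ ∀ j : Fin M,
      p * ((∏ i ∈ Finset.univ.erase j, (S i).coeff (fst i) ^ 2)
          * ((S j).coeff (fst j) * (S j).coeff (snd j)))
        ≤ (1 - p) * normFactor d * ((∏ i ∈ Finset.univ.erase j, (1 - (S i).coeff (fst i) ^ 2))
          * (1 + (S j).coeff (fst j) * (S j).coeff (snd j))) := by
    rw [hppt]
    refine forall_congr' fun j => ?_
    rw [pairEigenvalue, sub_nonneg, mul_assoc p, mul_assoc (_ * normFactor d)]
  refine ⟨fun j k m n hmn => ⟨star_pairVector_dotProduct_self S j k hmn,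
    schmidtRank_pairVector S j k hmn, partialTranspose_rhoP_mulVec_pairVector S j k m n⟩,
    fun h => ?_, hleast, hppt', fun hp hpos => ?_⟩
  · obtain ⟨j, hj⟩ := exists_eq_ciInf_of_finite
      (f := fun j : Fin M => pairEigenvalue (fun i => (S i).coeff) p j fst (fst j) (snd j))
    refine ⟨j, ?_⟩
    rw [IsNPT, hppt] at h
    push Not at h
    obtain ⟨l, hl⟩ := h
    -- NPT gives `Λ_l < 0 ≤ F(a)`, so the minimum in `hleast` is the infimum of the `Λ_j`.
    have hinf : (⨅ j : Fin M, pairEigenvalue (fun i => (S i).coeff) p j fst (fst j) (snd j))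
        ≤ mixedProd ((1 - p) * normFactor d) p fun i => (S i).coeff (fst i) ^ 2 :=
      ((ciInf_le (Set.finite_range _).bddBelow l).trans hl.le).trans
        (mixedProd_coeff_nonneg S hd hψ hp0 hp1)
    rw [min_eq_right hinf, ← hj] at hleast
    exact hleast
  -- Entanglement gives `μ₁ ≥ μ₂ > 0`, which makes every denominator positive; cross-multiplying
  -- then recovers the division-free condition for each `j`.
  · have hfpos (i) : 0 < (S i).coeff (fst i) := (hpos i).trans_le
      ((S i).coeff_antitone (Fin.le_def.mpr (by rw [hfst]; exact Nat.zero_le _)))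
    have hc : 0 < (1 - p) * normFactor d := mul_pos (by linarith) (normFactor_pos hd)
    rw [hppt', le_ciInf_iff (Set.finite_range _).bddBelow]
    refine forall_congr' fun j => ?_
    rw [div_le_div_iff₀ hc (mul_pos (Finset.prod_pos fun i _ => pow_pos (hfpos i) 2)
      (mul_pos (hfpos j) (hpos j))), mul_comm _ ((1 - p) * normFactor d)]
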